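/- A full binary tree of size $n$ is a plane rooted tree with $n$ internal nodes, each having a left and a right child, and $n+1$ leaves. A relaxed binary tree of size $n$ is obtained from a full binary tree of size $n$ by keeping its first leaf in post-order (left subtree, right subtree, root) and replacing each of the other $n$ leaves by a pointer to a node (an internal node or the kept leaf) that is visited before that leaf in the post-order traversal. Its right height is the maximal number of right edges on a path from the root to an internal node in the underlying full binary tree (and $0$ if $n=0$). For integers $k,n\ge 0$ let $r_{k,n}$ be the number of relaxed binary trees of size $n$ and right height at most $k$. Then for every $k\ge 0$ there is a constant $\gamma_k>0$, independent of $n$, such that, as $n\to\infty$, $$ r_{k,n} \sim \gamma_k\, n!\,\left(4\cos^2\left(\frac{\pi}{k+3}\right)\right)^{n} n^{-k/2}. $$ -/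

import Mathlib

namespace RelaxedTrees

/-- A plane full binary tree: `nil` is a leaf, `node` an internal node with its two children.
Its size is the number `BinaryTree.numNodes` of its internal nodes. -/
abbrev FullTree : Type := BinaryTree Unit

/-- The address of a node: the sequence of edges of the path from the root to that node,
with `false` for a left edge and `true` for a right edge. -/
abbrev Address : Type := List Bool

/-- The fringe subtree at an address (`none` if there is no node at that address). -/
def subtreeAt : FullTree → Address → Option FullTree
  | t, [] => some t
  | .nil, _ :: _ => none
  | .node _ l _, false :: a => subtreeAt l a
  | .node _ _ r, true :: a => subtreeAt r a

/-- There is a leaf of the full binary tree `t` at the address `a`. -/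
def IsLeaf (t : FullTree) (a : Address) : Prop :=
  subtreeAt t a = some .nil

/-- There is an internal node of `t` at the address `a`. The internal nodes are the nodes
of the spine. -/
def IsInternal (t : FullTree) (a : Address) : Prop :=
  ∃ l r : FullTree, subtreeAt t a = some (.node () l r)

/-- The addresses of all nodes (internal nodes and leaves) in the order of the post-order
traversal: left subtree, right subtree, root. -/
def postorder : FullTree → List Address
  | .nil => [[]]
  | .node _ l r =>
      (postorder l).map (fun a => false :: a) ++ (postorder r).map (fun a => true :: a) ++ [[]]

/-- The node at `a` is visited strictly before the node at `b` by the post-order traversal. -/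
def VisitedBefore (t : FullTree) (a b : Address) : Prop :=
  (postorder t).idxOf a < (postorder t).idxOf b

/-- The first leaf in the post-order traversal. It is the only leaf that is kept. -/
def IsFirstLeaf (t : FullTree) (a : Address) : Prop :=
  IsLeaf t a ∧ ∀ b : Address, IsLeaf t b → ¬ VisitedBefore t b a

/-- The positions of the pointers: all leaves but the first one. -/
def IsPointerPosition (t : FullTree) (a : Address) : Prop :=
  IsLeaf t a ∧ ¬ IsFirstLeaf t a

/-- The nodes that remain when all leaves but the first one are replaced by pointers:
the internal nodes and the unique leaf. -/
def IsNode (t : FullTree) (a : Address) : Prop :=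
  IsInternal t a ∨ IsFirstLeaf t a

/-- A relaxed binary tree of size `n`: a full binary tree with `n` internal nodes in which every
leaf but the first one (in post-order) is replaced by a pointer to a node that has been visited
before by the post-order traversal. -/
structure RelaxedTree (n : ℕ) where
  /-- The underlying full binary tree. -/
  tree : FullTree
  /-- The size is the number of internal nodes. -/
  size_eq : tree.numNodes = n
  /-- The target of each pointer. -/
  pointer : (a : {a : Address // IsPointerPosition tree a}) →
    {b : Address // IsNode tree b ∧ VisitedBefore tree b a}

/-- The right height of the spine: the maximal number of right edges on a path from the root to
an internal node (`0` for the tree of size `0`, whose spine is empty). -/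
noncomputable def rightHeight (t : FullTree) : ℕ :=
  sSup {m : ℕ | ∃ a : Address, IsInternal t a ∧ a.count true = m}

/-- The number of relaxed binary trees of size `n` and right height at most `k`. -/
noncomputable def relaxedCount (k n : ℕ) : ℕ :=
  Nat.card {T : RelaxedTree n // rightHeight T.tree ≤ k}

end RelaxedTrees

/-! ### Reduction from relaxed trees to weighted full binary trees. -/

namespace RelaxedTrees

open BinaryTree Finset

/-! ### Post-order positions -/

/-! A pointer chooses among the kept leaf and the internal nodes visited before it, so
`relaxedCount` is a sum of products over full trees (`relaxedCount_eq_sum`). Reading post-order as a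
stack process gives a linear recursion in the number of pointers (`prefixCount_succ`). After
division by `p!`, its matrix is `T (1 - D / (p + 1))`, with `T` a fixed 0/1 matrix of eigenvalue `4
cos² (π / (k + 3))` and `D = diag (0, …, k)`.

Pairing the solution with the left eigenvector `u` of `T`, corrected to first order in `1 / (p +
1)`, gives a scalar sequence with ratios `lam * (1 - θ / (p + 1) + O(p⁻²))` (`isBigO_ratio`), hence
asymptotic to a constant times `lam ^ p * p ^ (-θ)` (`tendsto_div_pow_mul_rpow`). The correction
exists when `θ` is the mean of `i` under the weights `u i * v i`, where `v` is the right
eigenvector; these weights are symmetric under `i ↦ k - i`, so `θ = k / 2`. Finally the solution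
aligns with `v`, by contraction of a stochastic matrix (`exists_contraction`, `tendsto_profile`),
which transfers the asymptotics to the entry `h = 0`. -/

theorem mem_postorder {t : FullTree} {a : Address} :
    a ∈ postorder t ↔ (subtreeAt t a).isSome := by
  induction t generalizing a with
  | nil => cases a <;> simp [postorder, subtreeAt]
  | node x l r hl hr =>
    rcases a with _ | ⟨_ | _, a⟩ <;> simp [postorder, subtreeAt, hl, hr]

theorem idxOf_map_cons (x : Bool) (l : List Address) (a : Address) :
    (l.map (fun a => x :: a)).idxOf (x :: a) = l.idxOf a := by
  induction l with
  | nil => rfl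
  | cons b l ih => simp [List.idxOf_cons, ih]

theorem idxOf_postorder_left {x : Unit} {l r : FullTree} {a : Address} (ha : a ∈ postorder l) :
    (postorder (.node x l r)).idxOf (false :: a) = (postorder l).idxOf a := by
  have h : false :: a ∈ (postorder l).map (fun a => false :: a) := List.mem_map_of_mem ha
  rw [postorder, List.append_assoc, List.idxOf_append_of_mem h]
  exact idxOf_map_cons _ _ a

theorem idxOf_postorder_right {x : Unit} {l r : FullTree} {a : Address} (ha : a ∈ postorder r) :
    (postorder (.node x l r)).idxOf (true :: a) =
      (postorder l).length + (postorder r).idxOf a := by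
  have h : true :: a ∈ (postorder r).map (fun a => true :: a) := List.mem_map_of_mem ha
  have h' : true :: a ∉ (postorder l).map (fun a => false :: a) := by simp
  rw [postorder, List.append_assoc, List.idxOf_append_of_notMem h', List.idxOf_append_of_mem h,
    List.length_map]
  congr 1
  exact idxOf_map_cons _ _ a

theorem idxOf_postorder_root {x : Unit} {l r : FullTree} :
    (postorder (.node x l r)).idxOf [] = (postorder l).length + (postorder r).length := by
  rw [postorder, List.idxOf_append_of_notMem (by simp)]
  simp

theorem IsInternal.mem_postorder {t : FullTree} {a : Address} (h : IsInternal t a) :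
    a ∈ postorder t := by
  obtain ⟨l, r, h⟩ := h
  simp [RelaxedTrees.mem_postorder, h]

theorem IsLeaf.mem_postorder {t : FullTree} {a : Address} (h : IsLeaf t a) :
    a ∈ postorder t := by
  rw [IsLeaf] at h
  simp [RelaxedTrees.mem_postorder, h]

@[simp] theorem not_isInternal_nil (a : Address) : ¬ IsInternal .nil a := by
  cases a <;> simp [IsInternal, subtreeAt]

@[simp] theorem isInternal_node_nil (x : Unit) (l r : FullTree) :
    IsInternal (.node x l r) [] := ⟨l, r, rfl⟩

@[simp] theorem isInternal_node_false (x : Unit) (l r : FullTree) (a : Address) :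
    IsInternal (.node x l r) (false :: a) ↔ IsInternal l a := Iff.rfl

@[simp] theorem isInternal_node_true (x : Unit) (l r : FullTree) (a : Address) :
    IsInternal (.node x l r) (true :: a) ↔ IsInternal r a := Iff.rfl

@[simp] theorem not_isLeaf_node_nil (x : Unit) (l r : FullTree) :
    ¬ IsLeaf (.node x l r) [] := by simp [IsLeaf, subtreeAt]

@[simp] theorem isLeaf_node_false (x : Unit) (l r : FullTree) (a : Address) :
    IsLeaf (.node x l r) (false :: a) ↔ IsLeaf l a := Iff.rfl

@[simp] theorem isLeaf_node_true (x : Unit) (l r : FullTree) (a : Address) :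
    IsLeaf (.node x l r) (true :: a) ↔ IsLeaf r a := Iff.rfl

/-! ### The first leaf -/

/-- The address of the first leaf in post-order. -/
def firstAddress : FullTree → Address
  | .nil => []
  | .node _ l _ => false :: firstAddress l

theorem isLeaf_firstAddress (t : FullTree) : IsLeaf t (firstAddress t) := by
  induction t with
  | nil => rfl
  | node x l r hl hr => exact hl

theorem idxOf_firstAddress (t : FullTree) : (postorder t).idxOf (firstAddress t) = 0 := by
  induction t with
  | nil => simp [postorder, firstAddress]
  | node x l r hl hr =>
    rw [firstAddress, idxOf_postorder_left (isLeaf_firstAddress l).mem_postorder, hl]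

theorem isFirstLeaf_iff {t : FullTree} {a : Address} : IsFirstLeaf t a ↔ a = firstAddress t := by
  constructor
  · rintro ⟨h, h'⟩
    have := h' _ (isLeaf_firstAddress t)
    rw [VisitedBefore, idxOf_firstAddress, not_lt, Nat.le_zero] at this
    exact (List.idxOf_inj h.mem_postorder).1 (this.trans (idxOf_firstAddress t).symm)
  · rintro rfl
    exact ⟨isLeaf_firstAddress t, fun b _ => by simp [VisitedBefore, idxOf_firstAddress]⟩

/-! ### Counting the targets of a pointer -/

/-- The internal nodes visited before the node at `a`. -/
def internalBefore (t : FullTree) (a : Address) : Set Address :=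
  {b | IsInternal t b ∧ VisitedBefore t b a}

/-- The number of internal nodes visited before the leaf at `a`. -/
def numBefore : FullTree → Address → ℕ
  | .node _ l _, false :: a => numBefore l a
  | .node _ l r, true :: a => l.numNodes + numBefore r a
  | _, _ => 0

theorem ncard_isInternal (t : FullTree) :
    {b | IsInternal t b}.Finite ∧ {b | IsInternal t b}.ncard = t.numNodes := by
  induction t with
  | nil => simp
  | node x l r hl hr =>
    have h : {b | IsInternal (.node x l r) b} =
        insert [] ((List.cons false) '' {b | IsInternal l b} ∪
          (List.cons true) '' {b | IsInternal r b}) := by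
      ext b
      rcases b with _ | ⟨_ | _, b⟩ <;> simp
    have hf := (hl.1.image (List.cons false)).union (hr.1.image (List.cons true))
    rw [h]
    refine ⟨hf.insert _, ?_⟩
    rw [Set.ncard_insert_of_notMem (by simp) hf, Set.ncard_union_eq _ (hl.1.image _) (hr.1.image _),
      Set.ncard_image_of_injective _ List.cons_injective,
      Set.ncard_image_of_injective _ List.cons_injective, hl.2, hr.2, numNodes]
    rw [Set.disjoint_left]
    rintro _ ⟨b, -, rfl⟩ ⟨c, -, h⟩
    simp at h

theorem finite_internalBefore (t : FullTree) (a : Address) : (internalBefore t a).Finite :=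
  (ncard_isInternal t).1.subset fun _ h => h.1

/-- The root comes after every leaf. A leaf on the left precedes the whole right subtree; a leaf on
the right follows the whole left subtree. -/
theorem ncard_internalBefore {t : FullTree} {a : Address} (ha : IsLeaf t a) :
    (internalBefore t a).ncard = numBefore t a := by
  induction t generalizing a with
  | nil => simp [internalBefore, numBefore]
  | node x l r hl hr =>
    rcases a with _ | ⟨_ | _, a⟩
    · simp at ha
    · have hla : IsLeaf l a := ha
      have h : internalBefore (.node x l r) (false :: a) =
          (List.cons false) '' internalBefore l a := by
        have hlt := List.idxOf_lt_length_of_mem hla.mem_postorder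
        ext b
        rcases b with _ | ⟨_ | _, b⟩
        · simp only [internalBefore, VisitedBefore, Set.mem_ofPred_eq, idxOf_postorder_root,
            idxOf_postorder_left hla.mem_postorder]
          simp
          omega
        · suffices IsInternal l b → (VisitedBefore (.node x l r) (false :: b) (false :: a) ↔
              VisitedBefore l b a) by
            simpa [internalBefore] using this
          intro hb
          simp [VisitedBefore, idxOf_postorder_left hla.mem_postorder,
            idxOf_postorder_left hb.mem_postorder]
        · simp only [internalBefore, Set.mem_ofPred_eq, isInternal_node_true]
          suffices IsInternal r b → ¬ VisitedBefore (.node x l r) (true :: b) (false :: a) by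
            simpa using this
          intro hb
          rw [VisitedBefore, idxOf_postorder_left hla.mem_postorder,
            idxOf_postorder_right hb.mem_postorder]
          omega
      rw [h, Set.ncard_image_of_injective _ List.cons_injective, hl hla, numBefore]
    · have hra : IsLeaf r a := ha
      have h : internalBefore (.node x l r) (true :: a) =
          (List.cons false) '' {b | IsInternal l b} ∪ (List.cons true) '' internalBefore r a := by
        have hlt := List.idxOf_lt_length_of_mem hra.mem_postorder
        ext b
        rcases b with _ | ⟨_ | _, b⟩
        · simp only [internalBefore, VisitedBefore, Set.mem_ofPred_eq, idxOf_postorder_root,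
            idxOf_postorder_right hra.mem_postorder]
          simp
          omega
        · suffices IsInternal l b → VisitedBefore (.node x l r) (false :: b) (true :: a) by
            simpa [internalBefore] using this
          intro hb
          have := List.idxOf_lt_length_of_mem hb.mem_postorder
          rw [VisitedBefore, idxOf_postorder_left hb.mem_postorder,
            idxOf_postorder_right hra.mem_postorder]
          omega
        · suffices IsInternal r b → (VisitedBefore (.node x l r) (true :: b) (true :: a) ↔
              VisitedBefore r b a) by
            simpa [internalBefore] using this
          intro hb
          simp [VisitedBefore, idxOf_postorder_right hra.mem_postorder,
            idxOf_postorder_right hb.mem_postorder]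
      rw [h, Set.ncard_union_eq _ ((ncard_isInternal l).1.image _)
          ((finite_internalBefore r a).image _),
        Set.ncard_image_of_injective _ List.cons_injective,
        Set.ncard_image_of_injective _ List.cons_injective, hr hra, (ncard_isInternal l).2,
        numBefore]
      rw [Set.disjoint_left]
      rintro _ ⟨b, -, rfl⟩ ⟨c, -, h⟩
      simp at h

theorem numBefore_firstAddress (t : FullTree) : numBefore t (firstAddress t) = 0 := by
  induction t with
  | nil => rfl
  | node x l r hl hr => exact hl

theorem not_isInternal_of_isLeaf {t : FullTree} {a : Address} (h : IsLeaf t a) :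
    ¬ IsInternal t a := by
  rintro ⟨l, r, h'⟩
  rw [IsLeaf] at h
  simp [h] at h'

theorem card_targets {t : FullTree} {a : Address} (ha : IsPointerPosition t a) :
    Nat.card {b : Address // IsNode t b ∧ VisitedBefore t b a} = 1 + numBefore t a := by
  have h : {b : Address | IsNode t b ∧ VisitedBefore t b a} =
      insert (firstAddress t) (internalBefore t a) := by
    ext b
    simp only [IsNode, isFirstLeaf_iff, internalBefore, Set.mem_ofPred_eq, Set.mem_insert_iff]
    have : VisitedBefore t (firstAddress t) a := by
      have h1 := ha.2
      rw [isFirstLeaf_iff] at h1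
      rw [VisitedBefore, idxOf_firstAddress, Nat.pos_iff_ne_zero]
      intro h0
      exact h1 ((List.idxOf_inj ha.1.mem_postorder).1 (h0.trans (idxOf_firstAddress t).symm))
    constructor
    · rintro ⟨h | h, h'⟩
      · exact Or.inr ⟨h, h'⟩
      · exact Or.inl h
    · rintro (rfl | h)
      · exact ⟨Or.inr rfl, this⟩
      · exact ⟨Or.inl h.1, h.2⟩
  change Nat.card ({b : Address | IsNode t b ∧ VisitedBefore t b a} : Set Address) = _
  rw [Nat.card_coe_set_eq, h, Set.ncard_insert_of_notMem _ (finite_internalBefore t a),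
    ncard_internalBefore ha.1, add_comm]
  exact fun h' => not_isInternal_of_isLeaf (isLeaf_firstAddress t) h'.1

/-! ### The weight of a tree -/

/-- The addresses of the leaves. -/
def leaves : FullTree → Finset Address
  | .nil => {[]}
  | .node _ l r => (leaves l).map ⟨List.cons false, List.cons_injective⟩ ∪
      (leaves r).map ⟨List.cons true, List.cons_injective⟩

@[simp] theorem mem_leaves {t : FullTree} {a : Address} : a ∈ leaves t ↔ IsLeaf t a := by
  induction t generalizing a with
  | nil => cases a <;> simp [leaves, IsLeaf, subtreeAt]
  | node x l r hl hr =>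
    rcases a with _ | ⟨_ | _, a⟩ <;> simp [leaves, hl, hr]

/-- The product over all leaves of `m` plus the number of internal nodes visited before the
leaf. -/
def leafWeight : FullTree → ℕ → ℕ
  | .nil, m => m
  | .node _ l r, m => leafWeight l m * leafWeight r (m + l.numNodes)

theorem prod_leaves (t : FullTree) (m : ℕ) :
    ∏ a ∈ leaves t, (m + numBefore t a) = leafWeight t m := by
  induction t generalizing m with
  | nil => simp [leaves, numBefore, leafWeight]
  | node x l r hl hr =>
    rw [leaves, prod_union, prod_map, prod_map, leafWeight, ← hl, ← hr]
    · simp [numBefore, add_assoc]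
    · rw [Finset.disjoint_left]
      intro a h h'
      simp only [mem_map, Function.Embedding.coeFn_mk] at h h'
      obtain ⟨b, -, rfl⟩ := h
      obtain ⟨c, -, h⟩ := h'
      simp at h

theorem finite_pointerPosition (t : FullTree) : Finite {a : Address // IsPointerPosition t a} :=
  ((leaves t).finite_toSet.subset fun _ ha => mem_leaves.2 ha.1 :
    {a | IsPointerPosition t a}.Finite)

theorem card_pointers (t : FullTree) :
    Nat.card ((a : {a : Address // IsPointerPosition t a}) →
      {b : Address // IsNode t b ∧ VisitedBefore t b a}) = leafWeight t 1 := by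
  have := finite_pointerPosition t
  have := Fintype.ofFinite {a : Address // IsPointerPosition t a}
  rw [Nat.card_pi, ← prod_leaves,
    -- The kept leaf carries no pointer, but its factor is `1 + 0`, so it may be included in the
    -- product.
    ← mul_prod_erase _ _ (mem_leaves.2 (isLeaf_firstAddress t)), numBefore_firstAddress,
    Finset.prod_congr rfl (fun a _ => card_targets a.2)]
  simp only [add_zero, one_mul]
  refine (Finset.prod_subtype _ (fun a => ?_) (fun a => 1 + numBefore t a)).symm
  simp [IsPointerPosition, isFirstLeaf_iff, and_comm]

/-! ### The right height -/

/-- Every leaf has at most `j` right edges above it. -/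
def RightBounded : ℕ → FullTree → Prop
  | _, .nil => True
  | 0, .node _ _ _ => False
  | j + 1, .node _ l r => RightBounded (j + 1) l ∧ RightBounded j r

/-- The inequality is strict because below the right edge of an internal node there is a leaf with
one more right edge above it. -/
theorem rightBounded_iff {j : ℕ} {t : FullTree} :
    RightBounded j t ↔ ∀ a, IsInternal t a → a.count true < j := by
  induction t generalizing j with
  | nil => cases j <;> simp [RightBounded]
  | node x l r hl hr =>
    cases j with
    | zero =>
      simp only [RightBounded, false_iff, not_forall]
      exact ⟨[], isInternal_node_nil _ _ _, by simp⟩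
    | succ j =>
      rw [RightBounded, hl, hr]
      constructor
      · rintro ⟨h1, h2⟩ (_ | ⟨_ | _, a⟩) ha
        · simp
        · simpa using h1 a ha
        · simpa using h2 a ha
      · intro h
        exact ⟨fun a ha => by simpa using h (false :: a) ha,
          fun a ha => by simpa using h (true :: a) ha⟩

theorem rightHeight_le_iff {k : ℕ} {t : FullTree} :
    rightHeight t ≤ k ↔ RightBounded (k + 1) t := by
  rw [rightBounded_iff, rightHeight]
  have hfin : {m : ℕ | ∃ a : Address, IsInternal t a ∧ a.count true = m}.Finite :=
    (ncard_isInternal t).1.image (List.count true)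
  constructor
  · intro h a ha
    exact Nat.lt_succ_of_le ((le_csSup hfin.bddAbove ⟨a, ha, rfl⟩).trans h)
  · intro h
    -- This form also covers the empty spine, where the supremum is `0`.
    refine csSup_le' ?_
    rintro _ ⟨a, ha, rfl⟩
    exact Nat.le_of_lt_succ (h a ha)

open Classical in
theorem relaxedCount_eq_sum (k n : ℕ) :
    relaxedCount k n = ∑ t ∈ treesOfNumNodesEq n with RightBounded (k + 1) t, leafWeight t 1 := by
  let e : {T : RelaxedTree n // rightHeight T.tree ≤ k} ≃
      Σ t : {t // t ∈ (treesOfNumNodesEq n).filter (RightBounded (k + 1))},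
        ((a : {a : Address // IsPointerPosition t.1 a}) →
          {b : Address // IsNode t.1 b ∧ VisitedBefore t.1 b a}) :=
    { toFun := fun T => ⟨⟨T.1.tree, by
        simp [mem_treesOfNumNodesEq, T.1.size_eq, ← rightHeight_le_iff, T.2]⟩, T.1.pointer⟩
      invFun := fun S => ⟨⟨S.1.1, mem_treesOfNumNodesEq.1 (mem_filter.1 S.1.2).1, S.2⟩,
        rightHeight_le_iff.2 (mem_filter.1 S.1.2).2⟩
      left_inv := fun T => rfl
      right_inv := fun S => rfl }
  have hfin (t : FullTree) : Finite ((a : {a : Address // IsPointerPosition t a}) →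
      {b : Address // IsNode t b ∧ VisitedBefore t b a}) := by
    have := finite_pointerPosition t
    have (a : {a : Address // IsPointerPosition t a}) :
        Finite {b : Address // IsNode t b ∧ VisitedBefore t b a} :=
      -- A nonzero `Nat.card` excludes its default value on infinite types.
      Nat.finite_of_card_ne_zero (by rw [card_targets a.2]; omega)
    infer_instance
  rw [relaxedCount, Nat.card_congr e, Nat.card_sigma]
  simp only [card_pointers]
  exact Finset.sum_coe_sort _ (fun t => leafWeight t 1)

end RelaxedTrees

/-! ### The stack process and its linear recursion. -/

namespace RelaxedTrees

open BinaryTree Finset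

/-! ### The weighted number of trees of bounded right height -/

open Classical in
/-- The sum of the weights of the trees of size `n` whose leaves have at most `j` right edges
above them. -/
noncomputable def treeSum (j n m : ℕ) : ℕ :=
  ∑ t ∈ treesOfNumNodesEq n with RightBounded j t, leafWeight t m

theorem treeSum_zero_right (j m : ℕ) : treeSum j 0 m = m := by
  cases j <;> simp [treeSum, sum_filter, RightBounded, leafWeight]

theorem sum_treesOfNumNodesEq_succ (n : ℕ) (f : FullTree → ℕ) :
    ∑ t ∈ treesOfNumNodesEq (n + 1), f t = ∑ p ∈ antidiagonal n,
      ∑ l ∈ treesOfNumNodesEq p.1, ∑ r ∈ treesOfNumNodesEq p.2, f (.node () l r) := by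
  rw [treesOfNumNodesEq_succ, sum_biUnion]
  · refine sum_congr rfl fun p _ => ?_
    rw [sum_map, sum_product]
    rfl
  · simp_rw [Set.PairwiseDisjoint, Set.Pairwise, disjoint_left]
    aesop

theorem treeSum_zero_succ (n m : ℕ) : treeSum 0 (n + 1) m = 0 := by
  simp [treeSum, sum_filter, sum_treesOfNumNodesEq_succ, RightBounded]

/-- Splitting at the root: leaves on the right see the left subtree's nodes as already visited and
have spent one right edge. -/
theorem treeSum_succ_succ (j n m : ℕ) :
    treeSum (j + 1) (n + 1) m =
      ∑ p ∈ antidiagonal n, treeSum (j + 1) p.1 m * treeSum j p.2 (m + p.1) := by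
  classical
  simp only [treeSum, sum_filter, sum_treesOfNumNodesEq_succ]
  refine sum_congr rfl fun p _ => ?_
  rw [sum_mul_sum]
  refine sum_congr rfl fun l hl => sum_congr rfl fun r _ => ?_
  rw [mem_treesOfNumNodesEq] at hl
  by_cases h1 : RightBounded (j + 1) l <;> by_cases h2 : RightBounded j r <;>
    simp [RightBounded, leafWeight, h1, h2, hl]

theorem relaxedCount_eq_treeSum (k n : ℕ) : relaxedCount k n = treeSum (k + 1) n 1 :=
  relaxedCount_eq_sum k n

/-! ### Forests on the stack of the post-order traversal -/

/-- The weighted number of forests of `s` trees with `q` internal nodes in total, where the leaves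
of the `i`-th tree have at most `K - i` right edges above them (`i = 0, …, s - 1`). -/
noncomputable def forestSum (K : ℕ) : ℕ → ℕ → ℕ
  | 0, q => if q = 0 then 1 else 0
  | s + 1, q => ∑ p ∈ antidiagonal q, forestSum K s p.1 * treeSum (K - s) p.2 (1 + p.1)

theorem sum_antidiagonal_assoc (n : ℕ) (f : ℕ → ℕ → ℕ → ℕ) :
    ∑ p ∈ antidiagonal n, ∑ r ∈ antidiagonal p.2, f p.1 r.1 r.2 =
      ∑ p ∈ antidiagonal n, ∑ r ∈ antidiagonal p.1, f r.1 r.2 p.2 := by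
  rw [sum_sigma', sum_sigma']
  refine sum_nbij' (fun x => ⟨(x.1.1 + x.2.1, x.2.2), (x.1.1, x.2.1)⟩)
    (fun x => ⟨(x.2.1, x.2.2 + x.1.2), (x.2.2, x.1.2)⟩) ?_ ?_ ?_ ?_ ?_
  all_goals
    rintro ⟨⟨a, b⟩, ⟨c, d⟩⟩ h
    simp only [mem_sigma, HasAntidiagonal.mem_antidiagonal] at h ⊢
  · refine ⟨?_, trivial⟩; omega
  · refine ⟨?_, trivial⟩; omega
  · obtain ⟨h, rfl⟩ := h; rfl
  · obtain ⟨h, rfl⟩ := h; rfl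

theorem forestSum_succ_zero (K s : ℕ) : forestSum K (s + 1) 0 = forestSum K s 0 := by
  simp [forestSum, treeSum_zero_right]

theorem forestSum_top (K q : ℕ) : forestSum K (K + 1) q = (1 + q) * forestSum K K q := by
  cases q with
  | zero => simp [forestSum_succ_zero]
  | succ q =>
    rw [forestSum, Nat.sum_antidiagonal_succ']
    simp [treeSum_zero_right, treeSum_zero_succ, mul_comm]

/-- The last tree is a leaf, with `q + 1` nodes before it, or its root can be removed. Its two
subtrees then have bounds `K - s` and `K - (s + 1)`, exactly those of the last two trees in a forest
of `s + 2`. -/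
theorem forestSum_succ_succ {K s : ℕ} (hs : s < K) (q : ℕ) :
    forestSum K (s + 1) (q + 1) =
      (2 + q) * forestSum K s (q + 1) + forestSum K (s + 2) q := by
  obtain ⟨j, hj⟩ : ∃ j, K - s = j + 1 := ⟨K - s - 1, by omega⟩
  have hj' : K - (s + 1) = j := by omega
  rw [forestSum, Nat.sum_antidiagonal_succ', forestSum]
  simp only [treeSum_zero_right, hj, hj', treeSum_succ_succ]
  congr 1
  · ring
  · simp only [forestSum, hj, mul_sum, sum_mul]
    rw [sum_antidiagonal_assoc q (fun a b c => forestSum K s a *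
      (treeSum (j + 1) b (1 + a) * treeSum j c (1 + a + b)))]
    refine sum_congr rfl fun p _ => sum_congr rfl fun r hr => ?_
    rw [HasAntidiagonal.mem_antidiagonal] at hr
    rw [← hr, mul_assoc, add_assoc]

/-! ### The transfer recursion -/

/-- The weighted number of prefixes of post-order traversals with `p` pointers, for which the
stack holds `h + 1` trees. -/
noncomputable def prefixCount (k p h : ℕ) : ℕ :=
  if h ≤ p ∧ h ≤ k + 1 then forestSum (k + 1) (h + 1) (p - h) else 0

theorem prefixCount_of_lt {k p h : ℕ} (hp : p < h) : prefixCount k p h = 0 := by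
  rw [prefixCount, if_neg (by omega)]

theorem relaxedCount_eq_prefixCount (k n : ℕ) : relaxedCount k n = prefixCount k n 0 := by
  rw [relaxedCount_eq_treeSum, prefixCount, if_pos (by omega), forestSum,
    sum_eq_single (0, n)]
  · simp [forestSum]
  · rintro ⟨a, b⟩ h hne
    have : a ≠ 0 := by
      rintro rfl
      simp_all
    simp [forestSum, this]
  · simp

theorem prefixCount_zero (k h : ℕ) : prefixCount k 0 h = if h = 0 then 1 else 0 := by
  rcases Nat.eq_zero_or_pos h with rfl | hh
  · simp [prefixCount, forestSum, treeSum_zero_right]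
  · rw [prefixCount_of_lt hh, if_neg hh.ne']

theorem prefixCount_succ_zero (k p : ℕ) : prefixCount k (p + 1) 0 = prefixCount k (p + 1) 1 := by
  simp only [prefixCount]
  rw [if_pos (by omega), if_pos (by omega), Nat.sub_zero, forestSum_succ_succ (by omega)]
  simp [forestSum]

/-- The last operation either pushed a pointer, with the kept leaf and `p - h` internal nodes as
targets, or merged the top two trees. -/
theorem prefixCount_succ_succ {k h : ℕ} (hh : h ≤ k) (p : ℕ) :
    prefixCount k (p + 1) (h + 1) =
      (p + 1 - h) * prefixCount k p h + prefixCount k (p + 1) (h + 2) := by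
  rcases lt_or_ge p h with hp | hp
  · rw [prefixCount_of_lt (by omega), prefixCount_of_lt hp, prefixCount_of_lt (by omega)]
    simp
  obtain ⟨q, rfl⟩ := Nat.exists_eq_add_of_le hp
  simp only [prefixCount]
  rw [if_pos (by omega), if_pos (by omega), show h + q + 1 - (h + 1) = q by omega,
    show h + q + 1 - h = 1 + q by omega, show h + q - h = q by omega]
  rcases hh.lt_or_eq with hk | rfl
  · cases q with
    | zero =>
      rw [if_neg (by omega), forestSum_succ_zero]
      simp
    | succ q =>
      rw [if_pos (by omega), forestSum_succ_succ (by omega),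
        show h + (q + 1) + 1 - (h + 2) = q by omega, show 1 + (q + 1) = 2 + q by omega]
  · rw [if_neg (by omega), forestSum_top, add_zero]

/-- One pointer is pushed onto level `i`, then any number of merges follow. The truncated `h - 1`
gives rows `0` and `1` the same sum. -/
theorem prefixCount_succ {k h : ℕ} (hh : h ≤ k + 1) (p : ℕ) :
    prefixCount k (p + 1) h = ∑ i ∈ Ico (h - 1) (k + 1), (p + 1 - i) * prefixCount k p i := by
  have key (h : ℕ) (hh : h ≤ k + 1) :
      prefixCount k (p + 1) (h + 1) = ∑ i ∈ Ico h (k + 1), (p + 1 - i) * prefixCount k p i := by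
    induction hh using Nat.decreasingInduction with
    | self => simp [prefixCount]
    | of_succ h hlt ih =>
      rw [sum_eq_sum_Ico_succ_bot hlt, prefixCount_succ_succ (by omega), ih]
  cases h with
  | zero => rw [prefixCount_succ_zero]; exact key 0 (by omega)
  | succ h => exact key h (by omega)

/-- The number of prefixes, divided by the factorial of the number of pointers. -/
noncomputable def scaledCount (k p h : ℕ) : ℝ := prefixCount k p h / p.factorial

theorem scaledCount_nonneg (k p h : ℕ) : 0 ≤ scaledCount k p h := by
  unfold scaledCount
  positivity

theorem scaledCount_succ {k h : ℕ} (hh : h ≤ k + 1) (p : ℕ) :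
    scaledCount k (p + 1) h =
      ∑ i ∈ Ico (h - 1) (k + 1), (1 - i / ((p : ℝ) + 1)) * scaledCount k p i := by
  simp only [scaledCount]
  rw [prefixCount_succ hh, Nat.factorial_succ, Nat.cast_sum, sum_div]
  refine sum_congr rfl fun i _ => ?_
  -- Truncated and real subtraction may differ for `i > p`, but the count vanishes there.
  rcases lt_or_ge p i with hp | hp
  · simp [prefixCount_of_lt hp]
  · have : (p.factorial : ℝ) ≠ 0 := by positivity
    have : (p : ℝ) + 1 ≠ 0 := by positivity
    push_cast [Nat.cast_sub (show i ≤ p + 1 by omega)]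
    field_simp

theorem relaxedCount_eq_scaledCount (k n : ℕ) :
    (relaxedCount k n : ℝ) = n.factorial * scaledCount k n 0 := by
  have : (n.factorial : ℝ) ≠ 0 := by positivity
  rw [relaxedCount_eq_prefixCount, scaledCount]
  field_simp

end RelaxedTrees

/-! ### Analytic tools: ratio asymptotics and contraction. -/

namespace RelaxedTrees

open Finset Filter Topology Asymptotics

/-! ### Sequences with prescribed ratios of consecutive terms -/

theorem isBigO_log_one_add_sub {a : ℕ → ℝ} (ha : Tendsto a atTop (𝓝 0)) :
    (fun n => Real.log (1 + a n) - a n) =O[atTop] fun n => a n ^ 2 := by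
  refine IsBigO.of_bound 2 ?_
  have h : ∀ᶠ n in atTop, |a n| < 1 / 2 := by
    have := ha.abs
    rw [abs_zero] at this
    exact this.eventually_lt_const (by norm_num)
  filter_upwards [h] with n hn
  have h1 := Real.abs_log_sub_add_sum_range_le (x := -a n) (by rw [abs_neg]; linarith) 1
  simp only [range_one, sum_singleton, zero_add, pow_one, Nat.cast_zero, div_one, abs_neg,
    sub_neg_eq_add, Nat.reduceAdd] at h1
  rw [Real.norm_eq_abs, Real.norm_eq_abs, abs_of_nonneg (sq_nonneg (a n)), sub_eq_neg_add]
  refine h1.trans ?_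
  rw [div_le_iff₀ (by linarith), sq_abs]
  nlinarith [sq_nonneg (a n)]

/-- The logarithm `L` of the normalised sequence has increments `O(p⁻²)`, so it converges, and the
exponential of its limit is positive. -/
theorem tendsto_div_pow_mul_rpow {f : ℕ → ℝ} {lam θ : ℝ} (hlam : 0 < lam)
    (hf : ∀ᶠ p in atTop, 0 < f p)
    (h : (fun p : ℕ => f (p + 1) / (lam * f p) - (1 - θ / ((p : ℝ) + 1))) =O[atTop]
      fun p : ℕ => 1 / ((p : ℝ) + 1) ^ 2) :
    ∃ c, 0 < c ∧ Tendsto (fun p : ℕ => f p / (lam ^ p * ((p : ℝ) + 1) ^ (-θ))) atTop (𝓝 c) := by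
  have hinv : Tendsto (fun p : ℕ => 1 / ((p : ℝ) + 1)) atTop (𝓝 0) :=
    tendsto_one_div_add_atTop_nhds_zero_nat
  have hO : (fun p : ℕ => 1 / ((p : ℝ) + 1) ^ 2) =O[atTop] fun p : ℕ => 1 / ((p : ℝ) + 1) := by
    refine IsBigO.of_bound 1 (Eventually.of_forall fun p => ?_)
    rw [Real.norm_eq_abs, Real.norm_eq_abs, abs_of_nonneg (by positivity),
      abs_of_nonneg (by positivity), one_mul]
    have : (1 : ℝ) ≤ (p : ℝ) + 1 := by linarith [p.cast_nonneg (α := ℝ)]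
    exact one_div_le_one_div_of_le (by positivity) (by nlinarith)
  set a : ℕ → ℝ := fun p => f (p + 1) / (lam * f p) - 1 with ha
  have haO : a =O[atTop] fun p : ℕ => 1 / ((p : ℝ) + 1) := by
    have h2 : (fun p : ℕ => -θ * (1 / ((p : ℝ) + 1))) =O[atTop] fun p : ℕ => 1 / ((p : ℝ) + 1) :=
      (isBigO_refl _ _).const_mul_left _
    refine ((h.trans hO).add h2).congr_left fun p => ?_
    simp only [ha]
    ring
  have hsq (b : ℕ → ℝ) (hb : b =O[atTop] fun p : ℕ => 1 / ((p : ℝ) + 1)) :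
      (fun p => Real.log (1 + b p) - b p) =O[atTop] fun p : ℕ => 1 / ((p : ℝ) + 1) ^ 2 := by
    refine (isBigO_log_one_add_sub (hb.trans_tendsto hinv)).trans ((hb.pow 2).congr_right ?_)
    intro p
    rw [div_pow, one_pow]
  set L : ℕ → ℝ := fun p => Real.log (f p / (lam ^ p * ((p : ℝ) + 1) ^ (-θ))) with hL
  have hdiff : (fun p => dist (L p) (L (p + 1))) =O[atTop] fun p : ℕ => 1 / ((p : ℝ) + 1) ^ 2 := by
    -- These three terms add up to `L (p + 1) - L p = log (1 + a p) + θ * log (1 + 1 / (p + 1))`;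
    -- the linear parts cancel.
    have h3 := ((hsq a haO).add ((hsq _ (isBigO_refl _ _)).const_mul_left θ)).add h
    refine h3.norm_left.congr' ?_ EventuallyEq.rfl
    filter_upwards [hf, (tendsto_add_atTop_nat 1).eventually hf] with p hp hp1
    have hp0 : (0 : ℝ) < (p : ℝ) + 1 := by positivity
    have e1 (q : ℕ) (hq : 0 < f q) : L q = Real.log (f q) - q * Real.log lam +
        θ * Real.log ((q : ℝ) + 1) := by
      have hq0 : (0 : ℝ) < (q : ℝ) + 1 := by positivity
      simp only [hL]
      rw [Real.log_div hq.ne' (by positivity), Real.log_mul (by positivity) (by positivity),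
        Real.log_pow, Real.log_rpow hq0]
      ring
    rw [dist_comm, Real.dist_eq, Real.norm_eq_abs, e1 p hp, e1 (p + 1) hp1]
    have e2 : Real.log (1 + a p) = Real.log (f (p + 1)) - (Real.log lam + Real.log (f p)) := by
      simp only [ha]
      rw [add_sub_cancel, Real.log_div hp1.ne' (by positivity), Real.log_mul hlam.ne' hp.ne']
    have e3 : Real.log (1 + 1 / ((p : ℝ) + 1)) =
        Real.log (((p + 1 : ℕ) : ℝ) + 1) - Real.log ((p : ℝ) + 1) := by
      rw [← Real.log_div (by positivity) hp0.ne']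
      congr 1
      push_cast
      field_simp
    rw [e2, e3]
    congr 1
    simp only [ha]
    push_cast
    ring
  have hsum : Summable fun p : ℕ => 1 / ((p : ℝ) + 1) ^ 2 := by
    have := (summable_nat_add_iff 1).2 (Real.summable_one_div_nat_pow.2 (one_lt_two))
    simpa using this
  obtain ⟨l, hl⟩ := cauchySeq_tendsto_of_complete
    (cauchySeq_of_summable_dist (summable_of_isBigO_nat hsum hdiff))
  refine ⟨Real.exp l, Real.exp_pos l, ?_⟩
  refine ((Real.continuous_exp.tendsto l).comp hl).congr' ?_
  filter_upwards [hf] with p hp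
  exact Real.exp_log (by positivity)

theorem tendsto_zero_of_le_mul_add {D E : ℕ → ℝ} {ρ : ℝ} (hρ : 0 ≤ ρ) (hρ1 : ρ < 1)
    (hD : ∀ p, 0 ≤ D p) (hE : Tendsto E atTop (𝓝 0)) (h : ∀ p, D (p + 1) ≤ ρ * D p + E p) :
    Tendsto D atTop (𝓝 0) := by
  rw [Metric.tendsto_atTop]
  intro ε hε
  obtain ⟨N, hN⟩ := eventually_atTop.1
    -- With this threshold, `ε / 2` is a fixed point of `d ↦ ρ * d + (1 - ρ) * (ε / 2)`.
    (hE.eventually_lt_const (show 0 < (1 - ρ) * (ε / 2) by nlinarith))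
  have key (j : ℕ) : D (N + j) ≤ ρ ^ j * D N + ε / 2 := by
    induction j with
    | zero => simp; linarith
    | succ j ih =>
      have h1 := h (N + j)
      have h2 := hN (N + j) (by omega)
      have h3 := mul_le_mul_of_nonneg_left ih hρ
      rw [← add_assoc, pow_succ]
      nlinarith
  have h0 : Tendsto (fun j => ρ ^ j * D N) atTop (𝓝 0) := by
    simpa using (tendsto_pow_atTop_nhds_zero_of_lt_one hρ hρ1).mul_const (D N)
  obtain ⟨J, hJ⟩ := eventually_atTop.1 (h0.eventually_lt_const (half_pos hε))
  refine ⟨N + J, fun n hn => ?_⟩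
  obtain ⟨j, rfl⟩ := Nat.exists_eq_add_of_le (show N ≤ n by omega)
  rw [Real.dist_eq, sub_zero, abs_of_nonneg (hD _)]
  linarith [key j, hJ j (by omega)]

/-! ### Averages -/

/-- Both bounds share the term `m + δ * (y k - m)`, so two averages giving `k` weight at least `δ`
differ by at most `(1 - δ) * C`. -/
theorem average_bounds {ι : Type*} [DecidableEq ι] {S : Finset ι} {w y : ι → ℝ} {k : ι}
    {m C δ : ℝ} (hk : k ∈ S) (hw : ∀ i ∈ S, 0 ≤ w i) (hw1 : ∑ i ∈ S, w i = 1) (hδ : δ ≤ w k)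
    (hm : ∀ i ∈ S, m ≤ y i) (hC : ∀ i ∈ S, y i ≤ m + C) :
    m + δ * (y k - m) ≤ ∑ i ∈ S, w i * y i ∧
      ∑ i ∈ S, w i * y i ≤ m + δ * (y k - m) + (1 - δ) * C := by
  have h1 : ∑ i ∈ S, w i * y i = m + (w k * (y k - m) + ∑ i ∈ S.erase k, w i * (y i - m)) := by
    rw [add_sum_erase S (fun i => w i * (y i - m)) hk]
    simp only [mul_sub, sum_sub_distrib, ← sum_mul, hw1]
    ring
  have h2 : w k + ∑ i ∈ S.erase k, w i = 1 := by rw [add_sum_erase S w hk, hw1]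
  have h3 : 0 ≤ ∑ i ∈ S.erase k, w i * (y i - m) := sum_nonneg fun i hi =>
    mul_nonneg (hw i (mem_of_mem_erase hi)) (sub_nonneg.2 (hm i (mem_of_mem_erase hi)))
  have h4 : ∑ i ∈ S.erase k, w i * (y i - m) ≤ (∑ i ∈ S.erase k, w i) * C := by
    rw [sum_mul]
    refine sum_le_sum fun i hi => mul_le_mul_of_nonneg_left ?_ (hw i (mem_of_mem_erase hi))
    linarith [hC i (mem_of_mem_erase hi)]
  have h5 := hm k hk
  have h6 := hC k hk
  constructor
  · nlinarith
  · nlinarith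

end RelaxedTrees

/-! ### Asymptotics of an abstract perturbed transfer system. -/

namespace RelaxedTrees

open Finset Filter Topology Asymptotics

/-! ### Perturbed transfer systems -/

/-- A nonnegative solution `x` of the recursion `x (p + 1) = T (1 - D / (p + 1)) (x p)` with
`T h i = 1` for `h ≤ i + 1` and `D = diag (0, …, k)`, together with a positive left eigenvector `u`
and a positive right eigenvector `v` of `T` for the eigenvalue `lam`, and a first-order
correction `s` of the left eigenvector. -/
structure TransferSystem (k : ℕ) (lam θ : ℝ) (u v s : ℕ → ℝ) (x : ℕ → ℕ → ℝ) : Prop where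
  lam_pos : 0 < lam
  u_pos : ∀ h ≤ k, 0 < u h
  u_top : u (k + 1) = 0
  v_pos : ∀ h ≤ k, 0 < v h
  left_eigen : ∀ i ≤ k, ∑ h ∈ range (i + 2), u h = lam * u i
  right_eigen : ∀ h ≤ k, ∑ i ∈ Ico (h - 1) (k + 1), v i = lam * v h
  s_top : s (k + 1) = 0
  left_corr : ∀ i ≤ k, ∑ h ∈ range (i + 2), s h = lam * s i + lam * ((i - θ) * u i)
  x_succ : ∀ p, ∀ h ≤ k + 1,
    x (p + 1) h = ∑ i ∈ Ico (h - 1) (k + 1), (1 - i / ((p : ℝ) + 1)) * x p i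
  x_nonneg : ∀ p h, 0 ≤ x p h
  x_pos : ∀ p, 0 < x p 0

theorem sum_mul_sum_Ico_pred (k : ℕ) (w y : ℕ → ℝ) :
    ∑ h ∈ range (k + 2), w h * ∑ i ∈ Ico (h - 1) (k + 1), y i =
      ∑ i ∈ range (k + 1), (∑ h ∈ range (i + 2), w h) * y i := by
  simp only [mul_sum, sum_mul]
  refine sum_comm' fun h i => ?_
  simp only [mem_range, mem_Ico]
  omega

/-- The corrected left eigenvector applied to `x p`. -/
noncomputable def correctedSum (k : ℕ) (u s : ℕ → ℝ) (x : ℕ → ℕ → ℝ) (p : ℕ) : ℝ :=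
  ∑ h ∈ range (k + 1), (u h + s h / ((p : ℝ) + 1)) * x p h

namespace TransferSystem

variable {k : ℕ} {lam θ : ℝ} {u v s : ℕ → ℝ} {x : ℕ → ℕ → ℝ}

theorem correctedSum_succ (H : TransferSystem k lam θ u v s x) (p : ℕ) :
    correctedSum k u s x (p + 1) = ∑ i ∈ range (k + 1),
      lam * (u i + (s i + (i - θ) * u i) / ((p : ℝ) + 2)) * ((1 - i / ((p : ℝ) + 1)) * x p i) := by
  -- Since `u` and `s` vanish at `k + 1`, that row can be added; the column sums of `T` are then
  -- complete.
  have h1 : correctedSum k u s x (p + 1) = ∑ h ∈ range (k + 2),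
      (u h + s h / ((p : ℝ) + 2)) *
        ∑ i ∈ Ico (h - 1) (k + 1), (1 - i / ((p : ℝ) + 1)) * x p i := by
    rw [sum_range_succ, H.u_top, H.s_top, correctedSum]
    simp only [zero_div, add_zero, zero_mul]
    refine sum_congr rfl fun h hh => ?_
    rw [H.x_succ p h (by rw [mem_range] at hh; omega)]
    push_cast
    rw [add_assoc (p : ℝ), one_add_one_eq_two]
  rw [h1, sum_mul_sum_Ico_pred]
  refine sum_congr rfl fun i hi => ?_
  have hik : i ≤ k := by rw [mem_range] at hi; omega
  rw [sum_add_distrib, ← sum_div, H.left_eigen i hik, H.left_corr i hik]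
  ring

/-- The equation `left_corr` for `s` is the one that makes the terms of order `1 / (p + 1)` cancel.
-/
theorem abs_correctedSum_succ_sub_le (H : TransferSystem k lam θ u v s x) :
    ∃ C, 0 ≤ C ∧ ∀ p : ℕ, |correctedSum k u s x (p + 1) -
      lam * (1 - θ / ((p : ℝ) + 1)) * correctedSum k u s x p| ≤
        C / ((p : ℝ) + 1) ^ 2 * ∑ i ∈ range (k + 1), x p i := by
  set c : ℕ → ℝ := fun i => lam * ((1 + i) * |s i + (i - θ) * u i| + |θ * s i|) with hc
  have hlam := H.lam_pos
  have hc0 (i : ℕ) : 0 ≤ c i := by simp only [hc]; positivity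
  refine ⟨∑ i ∈ range (k + 1), c i, sum_nonneg fun i _ => hc0 i, fun p => ?_⟩
  rw [H.correctedSum_succ, correctedSum, mul_sum, ← sum_sub_distrib, mul_sum]
  refine (abs_sum_le_sum_abs _ _).trans (sum_le_sum fun i hi => ?_)
  have hx := H.x_nonneg p i
  have hn : (0 : ℝ) < (p : ℝ) + 1 := by positivity
  set n : ℝ := (p : ℝ) + 1 with hn'
  have hp2 : (p : ℝ) + 2 = n + 1 := by rw [hn']; ring
  set a := s i + (i - θ) * u i with ha
  have e : lam * (u i + a / ((p : ℝ) + 2)) * ((1 - i / n) * x p i) -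
      lam * (1 - θ / n) * ((u i + s i / n) * x p i) =
      lam * (-((1 + i) * a / (n * (n + 1))) + θ * s i / n ^ 2) * x p i := by
    have : s i = a - (i - θ) * u i := by rw [ha]; ring
    rw [hp2, this]
    field_simp
    ring
  rw [e, abs_mul, abs_of_nonneg hx]
  refine mul_le_mul_of_nonneg_right ?_ hx
  have h1 : |lam * (-((1 + i) * a / (n * (n + 1))) + θ * s i / n ^ 2)| ≤ c i / n ^ 2 := by
    have hci : c i / n ^ 2 = lam * (((1 + i) * |a| + |θ * s i|) / n ^ 2) := mul_div_assoc _ _ _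
    rw [abs_mul, abs_of_pos hlam, hci]
    refine mul_le_mul_of_nonneg_left ((abs_add_le _ _).trans ?_) hlam.le
    rw [abs_neg, abs_div, abs_div, abs_mul, abs_of_nonneg (show (0 : ℝ) ≤ 1 + i by positivity),
      abs_of_pos (show 0 < n * (n + 1) by positivity), abs_of_pos (show 0 < n ^ 2 by positivity),
      add_div]
    gcongr
    nlinarith
  refine h1.trans ?_
  gcongr
  exact single_le_sum (f := c) (fun i _ => hc0 i) hi

/-- The sign of `s` is unknown, but eventually its contribution is at most half of `u h`, so all
summands are nonnegative. -/
theorem eventually_le_correctedSum (H : TransferSystem k lam θ u v s x) :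
    ∀ᶠ p : ℕ in atTop, ∀ h ≤ k, u h / 2 * x p h ≤ correctedSum k u s x p := by
  have h1 : ∀ᶠ p : ℕ in atTop, ∀ h ∈ range (k + 1), u h / 2 ≤ u h + s h / ((p : ℝ) + 1) := by
    rw [eventually_all_finset]
    intro h hh
    have hu := H.u_pos h (by rw [mem_range] at hh; omega)
    have ht : Tendsto (fun p : ℕ => u h + s h / ((p : ℝ) + 1)) atTop (𝓝 (u h)) := by
      have := (tendsto_one_div_add_atTop_nhds_zero_nat (𝕜 := ℝ)).const_mul (s h)
      simpa [div_eq_mul_inv] using this.const_add (u h)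
    exact (ht.eventually_const_lt (half_lt_self hu)).mono fun _ h => h.le
  filter_upwards [h1] with p hp h hh
  have hmem : h ∈ range (k + 1) := by rw [mem_range]; omega
  have hnn (i : ℕ) (hi : i ∈ range (k + 1)) : 0 ≤ (u i + s i / ((p : ℝ) + 1)) * x p i := by
    have hu := H.u_pos i (by rw [mem_range] at hi; omega)
    exact mul_nonneg (by linarith [hp i hi]) (H.x_nonneg p i)
  refine (mul_le_mul_of_nonneg_right (hp h hmem) (H.x_nonneg p h)).trans ?_
  exact single_le_sum (f := fun i => (u i + s i / ((p : ℝ) + 1)) * x p i) hnn hmem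

theorem eventually_correctedSum_pos (H : TransferSystem k lam θ u v s x) :
    ∀ᶠ p : ℕ in atTop, 0 < correctedSum k u s x p := by
  filter_upwards [H.eventually_le_correctedSum] with p hp
  have h1 := mul_pos (half_pos (H.u_pos 0 k.zero_le)) (H.x_pos p)
  exact h1.trans_le (hp 0 k.zero_le)

theorem isBigO_ratio (H : TransferSystem k lam θ u v s x) :
    (fun p : ℕ => correctedSum k u s x (p + 1) / (lam * correctedSum k u s x p) -
      (1 - θ / ((p : ℝ) + 1))) =O[atTop] fun p : ℕ => 1 / ((p : ℝ) + 1) ^ 2 := by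
  obtain ⟨C, hC, h⟩ := H.abs_correctedSum_succ_sub_le
  have hlam := H.lam_pos
  refine IsBigO.of_bound (C * (∑ i ∈ range (k + 1), 2 / u i) / lam) ?_
  filter_upwards [H.eventually_le_correctedSum, H.eventually_correctedSum_pos] with p hp hpos
  set f := correctedSum k u s x p
  have hsum : ∑ i ∈ range (k + 1), x p i ≤ (∑ i ∈ range (k + 1), 2 / u i) * f := by
    rw [sum_mul]
    refine sum_le_sum fun i hi => ?_
    have hik : i ≤ k := by rw [mem_range] at hi; omega
    have hu := H.u_pos i hik
    have h1 := hp i hik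
    rw [div_mul_eq_mul_div, le_div_iff₀ hu]
    linarith
  have e : correctedSum k u s x (p + 1) / (lam * f) - (1 - θ / ((p : ℝ) + 1)) =
      (correctedSum k u s x (p + 1) - lam * (1 - θ / ((p : ℝ) + 1)) * f) / (lam * f) := by
    field_simp
  rw [e, Real.norm_eq_abs, Real.norm_eq_abs, abs_div, abs_of_pos (mul_pos hlam hpos),
    abs_of_pos (show (0 : ℝ) < 1 / ((p : ℝ) + 1) ^ 2 by positivity),
    div_le_iff₀ (mul_pos hlam hpos)]
  refine (h p).trans ((mul_le_mul_of_nonneg_left hsum (by positivity)).trans_eq ?_)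
  field_simp

/-- The solution relative to the right eigenvector and to its corrected sum. -/
noncomputable def profile (k : ℕ) (u v s : ℕ → ℝ) (x : ℕ → ℕ → ℝ) (p h : ℕ) : ℝ :=
  x p h / (v h * correctedSum k u s x p)

theorem eventually_profile_le (H : TransferSystem k lam θ u v s x) :
    ∃ B, 0 ≤ B ∧ ∀ᶠ p : ℕ in atTop, ∀ h ≤ k,
      0 ≤ profile k u v s x p h ∧ profile k u v s x p h ≤ B := by
  have hb (i : ℕ) (hi : i ∈ range (k + 1)) : 0 ≤ 2 / (u i * v i) := by
    have hik : i ≤ k := by rw [mem_range] at hi; omega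
    have := H.u_pos i hik
    have := H.v_pos i hik
    positivity
  refine ⟨∑ i ∈ range (k + 1), 2 / (u i * v i), sum_nonneg hb, ?_⟩
  filter_upwards [H.eventually_le_correctedSum, H.eventually_correctedSum_pos] with p hp hpos h hh
  have hu := H.u_pos h hh
  have hv := H.v_pos h hh
  have hx := H.x_nonneg p h
  refine ⟨div_nonneg hx (by positivity), ?_⟩
  refine le_trans ?_ (single_le_sum hb (mem_range.2 (Nat.lt_succ_of_le hh)))
  rw [profile, div_le_div_iff₀ (by positivity) (by positivity)]
  nlinarith [hp h hh]

/-- The stochastic matrix obtained from `T` by conjugation with the right eigenvector. -/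
noncomputable def averaged (k : ℕ) (lam : ℝ) (v y : ℕ → ℝ) (h : ℕ) : ℝ :=
  ∑ i ∈ Ico (h - 1) (k + 1), v i / (lam * v h) * y i

theorem sum_weights (H : TransferSystem k lam θ u v s x) {h : ℕ} (hh : h ≤ k) :
    ∑ i ∈ Ico (h - 1) (k + 1), v i / (lam * v h) = 1 := by
  rw [← sum_div, H.right_eigen h hh, div_self]
  exact (mul_pos H.lam_pos (H.v_pos h hh)).ne'

theorem tendsto_ratio (H : TransferSystem k lam θ u v s x) :
    Tendsto (fun p => lam * correctedSum k u s x p / correctedSum k u s x (p + 1))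
      atTop (𝓝 1) := by
  have hinv : Tendsto (fun p : ℕ => 1 / ((p : ℝ) + 1)) atTop (𝓝 0) :=
    tendsto_one_div_add_atTop_nhds_zero_nat
  have h0 : Tendsto (fun p : ℕ => 1 / ((p : ℝ) + 1) ^ 2) atTop (𝓝 0) := by
    simpa using hinv.pow 2
  have h1 := (H.isBigO_ratio.trans_tendsto h0).add ((hinv.const_mul θ).const_sub 1)
  have h2 : Tendsto (fun p => correctedSum k u s x (p + 1) / (lam * correctedSum k u s x p))
      atTop (𝓝 1) := by
    have h3 : (0 : ℝ) + (1 - θ * 0) = 1 := by ring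
    rw [h3] at h1
    refine h1.congr fun p => ?_
    ring
  simpa using h2.inv₀ one_ne_zero

theorem exists_error (H : TransferSystem k lam θ u v s x) :
    ∃ E : ℕ → ℝ, (∀ p, 0 ≤ E p) ∧ Tendsto E atTop (𝓝 0) ∧ ∀ᶠ p : ℕ in atTop, ∀ h ≤ k,
      |profile k u v s x (p + 1) h - averaged k lam v (profile k u v s x p) h| ≤ E p := by
  obtain ⟨B, hB, hb⟩ := H.eventually_profile_le
  set f := correctedSum k u s x with hf
  set R : ℕ → ℝ := fun p => lam * f p / f (p + 1) with hR
  have hlam := H.lam_pos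
  refine ⟨fun p => (|R p - 1| + |R p| * (k * (1 / ((p : ℝ) + 1)))) * B, fun p => by positivity,
    ?_, ?_⟩
  · have h1 := H.tendsto_ratio
    have h2 := (h1.sub_const 1).abs
    have hinv : Tendsto (fun p : ℕ => 1 / ((p : ℝ) + 1)) atTop (𝓝 0) :=
      tendsto_one_div_add_atTop_nhds_zero_nat
    simpa using (h2.add (h1.abs.mul (hinv.const_mul (k : ℝ)))).mul_const B
  · filter_upwards [hb, H.eventually_correctedSum_pos,
      (tendsto_add_atTop_nat 1).eventually H.eventually_correctedSum_pos] with p hp hp0 hp1 h hh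
    have hv := H.v_pos h hh
    have e : profile k u v s x (p + 1) h - averaged k lam v (profile k u v s x p) h =
        ∑ i ∈ Ico (h - 1) (k + 1), v i / (lam * v h) *
          ((R p - 1 - R p * (i * (1 / ((p : ℝ) + 1)))) * profile k u v s x p i) := by
      rw [averaged, profile, H.x_succ p h (by omega), sum_div, ← sum_sub_distrib]
      refine sum_congr rfl fun i hi => ?_
      have hvi := H.v_pos i (by rw [mem_Ico] at hi; omega)
      simp only [profile, hR, hf]
      field_simp
      ring
    rw [e]
    refine (abs_sum_le_sum_abs _ _).trans ?_
    have hW (W : ℝ) : W = ∑ i ∈ Ico (h - 1) (k + 1), v i / (lam * v h) * W := by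
      rw [← sum_mul, H.sum_weights hh, one_mul]
    rw [hW ((|R p - 1| + |R p| * (k * (1 / ((p : ℝ) + 1)))) * B)]
    refine sum_le_sum fun i hi => ?_
    have hik : i ≤ k := by rw [mem_Ico] at hi; omega
    have hvi := H.v_pos i hik
    rw [abs_mul, abs_of_pos (show 0 < v i / (lam * v h) by positivity)]
    refine mul_le_mul_of_nonneg_left ?_ (by positivity)
    rw [abs_mul, abs_of_nonneg (hp i hik).1]
    refine mul_le_mul ?_ (hp i hik).2 (hp i hik).1 (by positivity)
    refine (abs_sub _ _).trans ?_
    rw [abs_mul (R p), abs_of_nonneg (show (0 : ℝ) ≤ i * (1 / ((p : ℝ) + 1)) by positivity)]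
    gcongr

/-- Doeblin's argument: every row gives the state `k` weight `v k / (lam * v h)`, and `lam * v h` is
a partial sum of `v`, hence at most `V`. -/
theorem exists_contraction (H : TransferSystem k lam θ u v s x) :
    ∃ ρ : ℝ, 0 ≤ ρ ∧ ρ < 1 ∧ ∀ (y : ℕ → ℝ) (C : ℝ), (∀ i ≤ k, ∀ j ≤ k, y i - y j ≤ C) →
      ∀ i ≤ k, ∀ j ≤ k, averaged k lam v y i - averaged k lam v y j ≤ ρ * C := by
  set V := ∑ i ∈ range (k + 1), v i with hV
  have hvn (i : ℕ) (hi : i ∈ range (k + 1)) : 0 ≤ v i :=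
    (H.v_pos i (by rw [mem_range] at hi; omega)).le
  have hvk := H.v_pos k le_rfl
  have hkV : v k ≤ V := single_le_sum hvn (by simp)
  have hlam := H.lam_pos
  have hVpos : 0 < V := hvk.trans_le hkV
  refine ⟨1 - v k / V, ?_, ?_, ?_⟩
  · rw [sub_nonneg]
    exact div_le_one_of_le₀ hkV hVpos.le
  · have := div_pos hvk hVpos
    linarith
  · intro y C hy i hi j hj
    obtain ⟨a, ha, hmin⟩ := exists_min_image (range (k + 1)) y ⟨0, by simp⟩
    have hak : a ≤ k := by rw [mem_range] at ha; omega
    have key (h : ℕ) (hh : h ≤ k) := average_bounds (S := Ico (h - 1) (k + 1))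
      (w := fun i => v i / (lam * v h)) (y := y) (k := k) (m := y a) (C := C) (δ := v k / V)
      (by rw [mem_Ico]; omega)
      (fun i hi => by
        have := H.v_pos i (by rw [mem_Ico] at hi; omega)
        have := H.v_pos h hh
        positivity)
      (H.sum_weights hh)
      (by
        have hvh := H.v_pos h hh
        rw [← H.right_eigen h hh]
        refine div_le_div_of_nonneg_left hvk.le ?_ ?_
        · rw [H.right_eigen h hh]
          positivity
        · refine sum_le_sum_of_subset_of_nonneg ?_ fun i hi _ => hvn i hi
          intro i hi
          rw [mem_Ico] at hi
          exact mem_range.2 hi.2)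
      (fun i hi => hmin i (by rw [mem_Ico] at hi; exact mem_range.2 hi.2))
      (fun i hi => by
        have := hy i (by rw [mem_Ico] at hi; omega) a hak
        linarith)
    have h1 := (key i hi).2
    have h2 := (key j hj).1
    simp only [averaged]
    linarith

theorem exists_oscillation (H : TransferSystem k lam θ u v s x) :
    ∃ D : ℕ → ℝ, Tendsto D atTop (𝓝 0) ∧ ∀ᶠ p : ℕ in atTop, ∀ i ≤ k, ∀ j ≤ k,
      profile k u v s x p i - profile k u v s x p j ≤ D p := by
  obtain ⟨ρ, hρ, hρ1, hcon⟩ := H.exists_contraction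
  obtain ⟨E, hE0, hE, herr⟩ := H.exists_error
  obtain ⟨B, hB, hb⟩ := H.eventually_profile_le
  obtain ⟨N, hN⟩ := eventually_atTop.1 (herr.and hb)
  -- The error enters twice, once for each of the two compared entries.
  let D : ℕ → ℝ := fun j => Nat.rec B (fun j d => ρ * d + 2 * E (N + j)) j
  have hD0 (j : ℕ) : 0 ≤ D j := by
    induction j with
    | zero => exact hB
    | succ j ih => exact add_nonneg (mul_nonneg hρ ih) (mul_nonneg zero_le_two (hE0 _))
  have hDt : Tendsto D atTop (𝓝 0) := by
    refine tendsto_zero_of_le_mul_add hρ hρ1 hD0 (E := fun j => 2 * E (N + j)) ?_ fun j => le_rfl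
    have := (tendsto_add_atTop_iff_nat N).2 hE
    simpa [add_comm] using this.const_mul 2
  have key (m : ℕ) : ∀ i ≤ k, ∀ j ≤ k,
      profile k u v s x (N + m) i - profile k u v s x (N + m) j ≤ D m := by
    induction m with
    | zero =>
      intro i hi j hj
      have h1 := ((hN N le_rfl).2 i hi).2
      have h2 := ((hN N le_rfl).2 j hj).1
      change _ ≤ B
      simp only [add_zero]
      linarith
    | succ m ih =>
      intro i hi j hj
      have h1 := abs_le.1 ((hN (N + m) (by omega)).1 i hi)
      have h2 := abs_le.1 ((hN (N + m) (by omega)).1 j hj)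
      have h3 := hcon _ _ ih i hi j hj
      change _ ≤ ρ * D m + 2 * E (N + m)
      rw [← add_assoc]
      linarith [h1.2, h2.1]
  refine ⟨fun p => D (p - N), hDt.comp (tendsto_sub_atTop_nat N), ?_⟩
  filter_upwards [eventually_ge_atTop N] with p hp
  obtain ⟨m, rfl⟩ := Nat.exists_eq_add_of_le hp
  simpa using key m

theorem tendsto_profile (H : TransferSystem k lam θ u v s x) :
    Tendsto (fun p => profile k u v s x p 0) atTop
      (𝓝 (1 / ∑ h ∈ range (k + 1), u h * v h)) := by
  obtain ⟨D, hD, hosc⟩ := H.exists_oscillation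
  obtain ⟨B, hB, hb⟩ := H.eventually_profile_le
  have hpos (h : ℕ) (hh : h ∈ range (k + 1)) : 0 < u h * v h := by
    have hk : h ≤ k := by rw [mem_range] at hh; omega
    exact mul_pos (H.u_pos h hk) (H.v_pos h hk)
  set U := ∑ h ∈ range (k + 1), u h * v h with hU
  have hUpos : 0 < U := sum_pos hpos ⟨0, by simp⟩
  set y := profile k u v s x with hy
  have h1 (h : ℕ) (hh : h ∈ range (k + 1)) :
      Tendsto (fun p => u h * v h * (y p h - y p 0) + s h * v h * (1 / ((p : ℝ) + 1) * y p h))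
        atTop (𝓝 0) := by
    have hk : h ≤ k := by rw [mem_range] at hh; omega
    have t1 : Tendsto (fun p => y p h - y p 0) atTop (𝓝 0) := by
      refine squeeze_zero_norm' ?_ hD
      filter_upwards [hosc] with p hp
      rw [Real.norm_eq_abs, abs_le]
      have a1 := hp h hk 0 k.zero_le
      have a2 := hp 0 k.zero_le h hk
      constructor <;> linarith
    have t2 : Tendsto (fun p : ℕ => 1 / ((p : ℝ) + 1) * y p h) atTop (𝓝 0) := by
      have hinv : Tendsto (fun p : ℕ => 1 / ((p : ℝ) + 1) * B) atTop (𝓝 0) := by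
        simpa using (tendsto_one_div_add_atTop_nhds_zero_nat (𝕜 := ℝ)).mul_const B
      refine squeeze_zero_norm' ?_ hinv
      filter_upwards [hb] with p hp
      rw [Real.norm_eq_abs, abs_of_nonneg (mul_nonneg (by positivity) (hp h hk).1)]
      exact mul_le_mul_of_nonneg_left (hp h hk).2 (by positivity)
    simpa using (t1.const_mul (u h * v h)).add (t2.const_mul (s h * v h))
  have h2 := tendsto_finsetSum _ h1
  rw [sum_const_zero] at h2
  have h3 := (h2.const_sub 1).div_const U
  rw [sub_zero] at h3
  refine h3.congr' ?_
  filter_upwards [H.eventually_correctedSum_pos] with p hp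
  rw [div_eq_iff hUpos.ne']
  -- This normalisation determines the common limit of the entries of the profile.
  have e : ∑ h ∈ range (k + 1), (u h + s h / ((p : ℝ) + 1)) * (v h * y p h) = 1 := by
    trans ∑ h ∈ range (k + 1),
      (u h + s h / ((p : ℝ) + 1)) * x p h / correctedSum k u s x p
    · refine sum_congr rfl fun h hh => ?_
      have hv := H.v_pos h (by rw [mem_range] at hh; omega)
      simp only [hy, profile]
      field_simp
    · rw [← sum_div]
      exact div_self hp.ne'
  have e' : ∑ h ∈ range (k + 1), (u h + s h / ((p : ℝ) + 1)) * (v h * y p h) =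
      ∑ h ∈ range (k + 1),
        (u h * v h * (y p h - y p 0) + s h * v h * (1 / ((p : ℝ) + 1) * y p h)) + y p 0 * U := by
    rw [hU, mul_sum, ← sum_add_distrib]
    refine sum_congr rfl fun h _ => ?_
    ring
  linarith

theorem exists_tendsto (H : TransferSystem k lam θ u v s x) :
    ∃ c, 0 < c ∧ Tendsto (fun p : ℕ => x p 0 / (lam ^ p * ((p : ℝ) + 1) ^ (-θ)))
      atTop (𝓝 c) := by
  obtain ⟨c, hc, h⟩ := tendsto_div_pow_mul_rpow H.lam_pos H.eventually_correctedSum_pos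
    H.isBigO_ratio
  have hv := H.v_pos 0 k.zero_le
  have hU : 0 < ∑ h ∈ range (k + 1), u h * v h := sum_pos (fun h hh => by
    have hk : h ≤ k := by rw [mem_range] at hh; omega
    exact mul_pos (H.u_pos h hk) (H.v_pos h hk)) ⟨0, by simp⟩
  refine ⟨c * (1 / (∑ h ∈ range (k + 1), u h * v h)) * v 0, by positivity, ?_⟩
  refine ((h.mul H.tendsto_profile).mul_const (v 0)).congr' ?_
  filter_upwards [H.eventually_correctedSum_pos] with p hp
  rw [profile]
  field_simp

end TransferSystem

end RelaxedTrees

/-! ### Explicit eigenvectors, the exponent `k / 2`, and the conclusion. -/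

namespace RelaxedTrees

open Finset Filter Topology Asymptotics

/-! ### The eigenvectors of the transfer matrix -/

/-- The left eigenvector of the transfer matrix. -/
noncomputable def leftVec (α : ℝ) (h : ℕ) : ℝ := (2 * Real.cos α) ^ h * Real.sin ((h + 2) * α)

/-- The right eigenvector of the transfer matrix. -/
noncomputable def rightVec (α : ℝ) (h : ℕ) : ℝ :=
  (2 * Real.cos α)⁻¹ ^ h * Real.sin ((h + 1) * α)

theorem sin_add_two_mul (α z : ℝ) :
    Real.sin ((z + 2) * α) = 2 * Real.cos α * Real.sin ((z + 1) * α) - Real.sin (z * α) := by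
  have h1 : (z + 2) * α = (z + 1) * α + α := by ring
  have h2 : z * α = (z + 1) * α - α := by ring
  rw [h1, h2, Real.sin_add, Real.sin_sub]
  ring

/-- Differences of consecutive equations are the three-term sine recurrence. Any `α` works here; the
size of the matrix enters only through `sin ((k + 3) * α) = 0`. -/
theorem sum_leftVec (α : ℝ) (i : ℕ) :
    ∑ h ∈ range (i + 2), leftVec α h = 4 * Real.cos α ^ 2 * leftVec α i := by
  induction i with
  | zero =>
    have h1 := sin_add_two_mul α 1
    have h2 := sin_add_two_mul α 0
    norm_num at h1 h2
    rw [sum_range_succ, sum_range_one, leftVec, leftVec]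
    norm_num
    rw [h1, h2]
    ring
  | succ i ih =>
    rw [sum_range_succ, ih, leftVec, leftVec, leftVec]
    have h := sin_add_two_mul α ((i : ℝ) + 2)
    push_cast
    rw [show (i : ℝ) + 2 + 2 = i + 4 by ring, show (i : ℝ) + 2 + 1 = i + 3 by ring] at h
    rw [show (i : ℝ) + 2 + 2 = i + 4 by ring, show (i : ℝ) + 1 + 2 = i + 3 by ring, h]
    ring

variable {α : ℝ}

theorem rightVec_add (hα : Real.cos α ≠ 0) (h : ℕ) :
    rightVec α h + 4 * Real.cos α ^ 2 * rightVec α (h + 2) =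
      4 * Real.cos α ^ 2 * rightVec α (h + 1) := by
  have e := sin_add_two_mul α ((h : ℝ) + 1)
  simp only [rightVec]
  push_cast
  rw [show (h : ℝ) + 1 + 2 = h + 2 + 1 by ring] at e
  rw [e, inv_pow, inv_pow, inv_pow]
  field_simp
  ring

theorem sum_rightVec {k : ℕ} (hα : Real.cos α ≠ 0) (htop : Real.sin ((k + 3) * α) = 0) {h : ℕ}
    (hh : h ≤ k + 1) :
    ∑ i ∈ Ico (h - 1) (k + 1), rightVec α i = 4 * Real.cos α ^ 2 * rightVec α h := by
  have key (h : ℕ) (hh : h ≤ k + 1) :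
      ∑ i ∈ Ico h (k + 1), rightVec α i = 4 * Real.cos α ^ 2 * rightVec α (h + 1) := by
    induction hh using Nat.decreasingInduction with
    | self =>
      have : rightVec α (k + 1 + 1) = 0 := by
        rw [rightVec]
        push_cast
        rw [show (k : ℝ) + 1 + 1 + 1 = k + 3 by ring, htop, mul_zero]
      rw [this]
      simp
    | of_succ h hlt ih => rw [sum_eq_sum_Ico_succ_bot hlt, ih, rightVec_add hα]
  cases h with
  | zero =>
    rw [key 0 (by omega)]
    have : rightVec α 1 = rightVec α 0 := by
      have := sin_add_two_mul α 0
      norm_num at this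
      simp only [rightVec]
      norm_num
      rw [this]
      field_simp
    rw [this]
  | succ h => exact key h (by omega)

theorem leftVec_mul_rightVec (hα : Real.cos α ≠ 0) (h : ℕ) :
    leftVec α h * rightVec α h = Real.sin ((h + 2) * α) * Real.sin ((h + 1) * α) := by
  rw [leftVec, rightVec, inv_pow]
  field_simp

theorem sum_centered {k : ℕ} (c : ℕ → ℝ) (hc : ∀ i ≤ k, c (k - i) = c i) :
    ∑ i ∈ range (k + 1), ((i : ℝ) - k / 2) * c i = 0 := by
  have h := sum_range_reflect (fun i => ((i : ℝ) - k / 2) * c i) (k + 1)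
  have h' : ∑ i ∈ range (k + 1), (((k + 1 - 1 - i : ℕ) : ℝ) - k / 2) * c (k + 1 - 1 - i) =
      -∑ i ∈ range (k + 1), ((i : ℝ) - k / 2) * c i := by
    rw [← sum_neg_distrib]
    refine sum_congr rfl fun i hi => ?_
    have hik : i ≤ k := by rw [mem_range] at hi; omega
    rw [Nat.add_sub_cancel, hc i hik, Nat.cast_sub hik]
    ring
  linarith

/-- The first-order correction of the left eigenvector `u`. -/
noncomputable def correction (lam θ : ℝ) (u : ℕ → ℝ) : ℕ → ℝ
  | 0 => 0
  | h + 1 => lam * correction lam θ u h + lam * ((h - θ) * u h) -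
      ∑ i : Fin (h + 1), correction lam θ u i

theorem sum_correction (lam θ : ℝ) (u : ℕ → ℝ) (i : ℕ) :
    ∑ h ∈ range (i + 2), correction lam θ u h =
      lam * correction lam θ u i + lam * ((i - θ) * u i) := by
  rw [sum_range_succ, correction, sum_range]
  ring

/-- Fredholm solvability: pairing the equations for the correction with `v` cancels everything
except its top entry times `v k` and `lam` times the sum in `hθ`. -/
theorem correction_top {k : ℕ} {lam θ : ℝ} {u v : ℕ → ℝ} (hv : v k ≠ 0)
    (hright : ∀ h ≤ k, ∑ i ∈ Ico (h - 1) (k + 1), v i = lam * v h)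
    (hθ : ∑ i ∈ range (k + 1), (i - θ) * (u i * v i) = 0) :
    correction lam θ u (k + 1) = 0 := by
  have h := sum_mul_sum_Ico_pred k (correction lam θ u) v
  rw [sum_range_succ] at h
  have h1 : ∑ h ∈ range (k + 1), correction lam θ u h * ∑ i ∈ Ico (h - 1) (k + 1), v i =
      ∑ i ∈ range (k + 1), lam * correction lam θ u i * v i := by
    refine sum_congr rfl fun i hi => ?_
    rw [hright i (by rw [mem_range] at hi; omega)]
    ring
  have h2 : ∑ i ∈ range (k + 1), (∑ h ∈ range (i + 2), correction lam θ u h) * v i =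
      ∑ i ∈ range (k + 1), lam * correction lam θ u i * v i +
        lam * ∑ i ∈ range (k + 1), (i - θ) * (u i * v i) := by
    rw [mul_sum, ← sum_add_distrib]
    refine sum_congr rfl fun i _ => ?_
    rw [sum_correction]
    ring
  rw [h1, h2, hθ, Nat.add_sub_cancel, Nat.Ico_succ_singleton, sum_singleton] at h
  have : correction lam θ u (k + 1) * v k = 0 := by linarith
  exact (mul_eq_zero.1 this).resolve_right hv

theorem scaledCount_pos (k p : ℕ) : 0 < scaledCount k p 0 := by
  have h : 0 < prefixCount k p 0 := by
    induction p with
    | zero => simp [prefixCount_zero]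
    | succ p ih =>
      rw [prefixCount_succ (by omega)]
      refine lt_of_lt_of_le ?_ (single_le_sum (fun _ _ => Nat.zero_le _)
        (show 0 ∈ Ico (0 - 1) (k + 1) by simp))
      exact Nat.mul_pos (by omega) ih
  unfold scaledCount
  positivity

theorem transferSystem_scaledCount (k : ℕ) :
    TransferSystem k (4 * Real.cos (Real.pi / ((k : ℝ) + 3)) ^ 2) (k / 2)
      (leftVec (Real.pi / ((k : ℝ) + 3))) (rightVec (Real.pi / ((k : ℝ) + 3)))
      (correction (4 * Real.cos (Real.pi / ((k : ℝ) + 3)) ^ 2) (k / 2)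
        (leftVec (Real.pi / ((k : ℝ) + 3)))) (scaledCount k) := by
  have hk : (0 : ℝ) < (k : ℝ) + 3 := by positivity
  set α := Real.pi / ((k : ℝ) + 3) with hα
  have hα0 : 0 < α := div_pos Real.pi_pos hk
  have hmul : ((k : ℝ) + 3) * α = Real.pi := by rw [hα]; field_simp
  have hcos : 0 < Real.cos α := by
    have : (0 : ℝ) ≤ k := k.cast_nonneg
    refine Real.cos_pos_of_mem_Ioo ⟨by linarith [Real.pi_pos], ?_⟩
    nlinarith
  have hsin (z : ℝ) (hz : 0 < z) (hz' : z < k + 3) : 0 < Real.sin (z * α) :=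
    Real.sin_pos_of_pos_of_lt_pi (by positivity) (by rw [← hmul]; gcongr)
  have htop : Real.sin (((k : ℝ) + 3) * α) = 0 := by rw [hmul, Real.sin_pi]
  have hv (h : ℕ) (hh : h ≤ k) : 0 < rightVec α h := by
    have : (h : ℝ) ≤ k := by exact_mod_cast hh
    have := hsin (h + 1) (by positivity) (by linarith)
    rw [rightVec]
    positivity
  have hright (h : ℕ) (hh : h ≤ k) := sum_rightVec hcos.ne' htop (show h ≤ k + 1 by omega)
  refine ⟨by positivity, fun h hh => ?_, ?_, hv, fun i _ => sum_leftVec α i, hright, ?_,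
    fun i _ => sum_correction _ _ _ i, fun p h hh => scaledCount_succ hh p, scaledCount_nonneg k,
    scaledCount_pos k⟩
  · have : (h : ℝ) ≤ k := by exact_mod_cast hh
    have := hsin (h + 2) (by positivity) (by linarith)
    rw [leftVec]
    positivity
  · rw [leftVec]
    push_cast
    rw [show (k : ℝ) + 1 + 2 = k + 3 by ring, htop, mul_zero]
  · refine correction_top (hv k le_rfl).ne' hright
      (sum_centered (fun i => leftVec α i * rightVec α i) fun i hi => ?_)
    -- The powers of `2 cos α` cancel, and since `(k + 3) * α = π`, the map `i ↦ k - i` swaps the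
    -- two remaining sines.
    simp only [leftVec_mul_rightVec hcos.ne']
    rw [Nat.cast_sub hi, mul_comm]
    congr 1
    · rw [show ((k : ℝ) - i + 1) * α = Real.pi - (i + 2) * α by rw [← hmul]; ring,
        Real.sin_pi_sub]
    · rw [show ((k : ℝ) - i + 2) * α = Real.pi - (i + 1) * α by rw [← hmul]; ring,
        Real.sin_pi_sub]

theorem tendsto_succ_rpow_div_rpow (θ : ℝ) :
    Tendsto (fun n : ℕ => ((n : ℝ) + 1) ^ θ / (n : ℝ) ^ θ) atTop (𝓝 1) := by
  have h1 : Tendsto (fun n : ℕ => 1 + 1 / (n : ℝ)) atTop (𝓝 1) := by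
    simpa using (tendsto_one_div_atTop_nhds_zero_nat (𝕜 := ℝ)).const_add 1
  have h2 := h1.rpow_const (p := θ) (Or.inl one_ne_zero)
  rw [Real.one_rpow] at h2
  refine h2.congr' ?_
  filter_upwards [eventually_gt_atTop 0] with n hn
  have hn' : (0 : ℝ) < n := by exact_mod_cast hn
  rw [← Real.div_rpow (by positivity) hn'.le]
  congr 1
  field_simp

end RelaxedTrees

theorem theorem3p1 (k : ℕ) :
    ∃ γ : ℝ, 0 < γ ∧
      Asymptotics.IsEquivalent Filter.atTop
        (fun n : ℕ => (RelaxedTrees.relaxedCount k n : ℝ))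
        (fun n : ℕ => γ * (n.factorial : ℝ) * (4 * Real.cos (Real.pi / ((k : ℝ) + 3)) ^ 2) ^ n *
          (n : ℝ) ^ (-(k : ℝ) / 2)) := by
  have H := RelaxedTrees.transferSystem_scaledCount k
  have hlam := H.lam_pos
  obtain ⟨c, hc, h⟩ := H.exists_tendsto
  refine ⟨c, hc, Asymptotics.isEquivalent_of_tendsto_one ?_⟩
  have h1 := (h.div_const c).mul (RelaxedTrees.tendsto_succ_rpow_div_rpow (-((k : ℝ) / 2)))
  rw [div_self hc.ne', one_mul] at h1
  refine h1.congr' ?_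
  filter_upwards [Filter.eventually_gt_atTop 0] with n hn
  have hn' : (0 : ℝ) < n := by exact_mod_cast hn
  have e1 : (0 : ℝ) < (n : ℝ) ^ (-((k : ℝ) / 2)) := by positivity
  have e2 : (0 : ℝ) < ((n : ℝ) + 1) ^ (-((k : ℝ) / 2)) := by positivity
  have e3 : (0 : ℝ) < n.factorial := by positivity
  simp only [Pi.div_apply]
  rw [RelaxedTrees.relaxedCount_eq_scaledCount, neg_div]
  set lam := 4 * Real.cos (Real.pi / ((k : ℝ) + 3)) ^ 2
  field_simp
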